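/- Let $\mathbb{T}\subseteq\mathbb{R}$ be a time scale (a nonempty closed set), let $a,b\in\mathbb{T}$ with $a<b$, put $I_{\mathbb T}=[a,\infty)\cap\mathbb{T}$, and let $\mathbb{X}$ be a Banach space. Let $f:I_{\mathbb T}\times\mathbb{X}^3\to\mathbb{X}$ be rd-continuous in its first variable and let $h,g:I_{\mathbb T}^2\times\mathbb{X}\to\mathbb{X}$ be rd-continuous in their second variable. Suppose that there are rd-continuous functions $k_1,k_2,k_3:I_{\mathbb T}\to[0,\infty)$ such that, for all $t,s\in I_{\mathbb T}$ and all $u,\bar u,v,\bar v,w,\bar w\in\mathbb{X}$, $$\|f(t,u,v,w)-f(t,\bar u,\bar v,\bar w)\|\le k_1(t)\{\|u-\bar u\|+\|v-\bar v\|+\|w-\bar w\|\},$$ $$\|h(t,s,v)-h(t,s,\bar v)\|\le k_2(s)\|v-\bar v\|,\qquad \|g(t,s,u)-g(t,s,\bar u)\|\le k_3(s)\|u-\bar u\|,$$ and that $$r:=\int_a^b k_3(\tau)\,e_{k_1+k_2}(\tau,a)\,\Delta\tau<1 .$$ Here $\int\cdot\,\Delta\tau$ is the delta integral (defined through antiderivatives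 with respect to the delta derivative) and $e_p(t,s)=\exp\big(\int_s^t\xi_{\mu(\tau)}(p(\tau))\Delta\tau\big)$ is the generalized exponential function, where $\mu(\tau)=\inf\{s\in\mathbb{T}:s>\tau\}-\tau$ is the graininess of $\mathbb T$ (zero at a maximum of $\mathbb T$), $\xi_0(z)=z$, and $\xi_h(z)=\log(1+hz)/h$ for $h>0$. Let $x$ be any solution of the integro-dynamic equation $$x^\Delta(t)=f\Big(t,x(t),\int_a^t h(t,s,x(s))\Delta s,\int_a^b g(t,s,x(s))\Delta s\Big),\qquad t\in I_{\mathbb T},$$ that is, an rd-continuous $x:I_{\mathbb T}\to\mathbb{X}$ satisfying the equation at every $t\in I_{\mathbb T}$ other than a left-scattered maximum of $I_{\mathbb T}$. Suppose that the outer delta integral in $$m:=\sup_{t\in I_{\mathbb T}}\Big\|x(a)+\int_a^t f\Big(\tau,0,\int_a^\tau h(\tau,s,0)\Delta s,\int_a^b g(\tau,s,0)\Delta s\Big)\Delta\tau\Big\|$$ exists for every $t\in I_{\mathbb T}$ and that $m<\infty$. Then $$\|x(t)\|\le\frac{m}{1-r}\,e_{k_1+k_2}(t,a)\qquad\text{for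 all } t\in I_{\mathbb T}.$$ -/

import Mathlib

open Set Filter Topology

noncomputable section

namespace TimeScale

variable {E : Type*} [NormedAddCommGroup E] [NormedSpace ℝ E]

/-- The part `[a, ∞)_𝕋 = [a, ∞) ∩ 𝕋` of a time scale; it is again a time scale when `a ∈ 𝕋`.
Functions on a time scale `T` are written as functions on `ℝ`; only their values on `T` are used. -/
def tail (T : Set ℝ) (a : ℝ) : Set ℝ := T ∩ Ici a

open Classical in
/-- Forward jump `σ(t) = inf {s ∈ T : s > t}`, with the convention `inf ∅ = sup T`
(for `t ∈ T` with no larger element, `sup T = t`). -/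
def forwardJump (T : Set ℝ) (t : ℝ) : ℝ :=
  if (T ∩ Ioi t).Nonempty then sInf (T ∩ Ioi t) else t

open Classical in
/-- Backward jump `ρ(t) = sup {s ∈ T : s < t}`, with the convention `sup ∅ = inf T`. -/
def backwardJump (T : Set ℝ) (t : ℝ) : ℝ :=
  if (T ∩ Iio t).Nonempty then sSup (T ∩ Iio t) else t

/-- Graininess `μ(t) = σ(t) - t`. -/
def graininess (T : Set ℝ) (t : ℝ) : ℝ := forwardJump T t - t

/-- `t < sup T` and `σ(t) = t`. -/
def RightDense (T : Set ℝ) (t : ℝ) : Prop := (T ∩ Ioi t).Nonempty ∧ forwardJump T t = t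

/-- `t > inf T` and `ρ(t) = t`. -/
def LeftDense (T : Set ℝ) (t : ℝ) : Prop := (T ∩ Iio t).Nonempty ∧ backwardJump T t = t

/-- `T^κ`: the time scale without its left-scattered maximum, if there is one. -/
def kappa (T : Set ℝ) : Set ℝ := {t ∈ T | ¬ (IsGreatest T t ∧ backwardJump T t < t)}

/-- `F` is delta differentiable at `t` with delta derivative `F'`. -/
def HasDeltaDerivAt (T : Set ℝ) (F : ℝ → E) (F' : E) (t : ℝ) : Prop :=
  ∀ ε > 0, ∃ U ∈ 𝓝 t, ∀ s ∈ U ∩ T,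
    ‖(F (forwardJump T t) - F s) - (forwardJump T t - s) • F'‖ ≤ ε * |forwardJump T t - s|

/-- Rd-continuity: continuous at right-dense points, with (finite) left-sided limits at
left-dense points. -/
def RdContinuous (T : Set ℝ) (f : ℝ → E) : Prop :=
  (∀ t ∈ T, RightDense T t → ContinuousWithinAt f T t) ∧
  (∀ t ∈ T, LeftDense T t → ∃ l : E, Tendsto f (𝓝[T ∩ Iio t] t) (𝓝 l))

/-- `F` is an antiderivative of `f` on `[r, s]_T`: it is continuous there and `F^Δ = f` on
`[r, s)_T`. The restriction to `[r, s]_T` of a function with `F^Δ = f` on all of `T^κ` is one. The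
right endpoint carries no condition on `f`, since the integral from `r` to `s` does not involve
`f s`. -/
def IsAntiderivativeOn (T : Set ℝ) (F f : ℝ → E) (r s : ℝ) : Prop :=
  ContinuousOn F (T ∩ Icc r s) ∧ ∀ t ∈ T ∩ Ico r s, HasDeltaDerivAt T F (f t) t

/-- The delta integral of `f` between `r` and `s` exists. -/
def DeltaIntegrable (T : Set ℝ) (f : ℝ → E) (r s : ℝ) : Prop :=
  ∃ F : ℝ → E, IsAntiderivativeOn T F f (min r s) (max r s)

open Classical in
/-- The (Cauchy) delta integral `∫_r^s f(t) Δt = F(s) - F(r)`, for `F` an antiderivative of `f`;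
it is given the value `0` if there is none. -/
def deltaIntegral (T : Set ℝ) (f : ℝ → E) (r s : ℝ) : E :=
  if H : DeltaIntegrable T f r s then H.choose s - H.choose r else 0

/-- The cylinder transformation `ξ_h(z)`. -/
def cylinder (h z : ℝ) : ℝ := if h = 0 then z else Real.log (1 + h * z) / h

/-- The generalized exponential function `e_p(t, s) = exp (∫_s^t ξ_{μ(τ)}(p(τ)) Δτ)`. -/
def deltaExp (T : Set ℝ) (p : ℝ → ℝ) (t s : ℝ) : ℝ :=
  Real.exp (deltaIntegral T (fun τ => cylinder (graininess T τ) (p τ)) s t)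

/-- The right-hand side
`f (t, x(t), ∫_a^t h(t, s, x(s)) Δs, ∫_a^b g(t, s, x(s)) Δs)`. -/
def volterraFredholm (I : Set ℝ) (a b : ℝ) (f : ℝ → E → E → E → E) (h g : ℝ → ℝ → E → E)
    (x : ℝ → E) (t : ℝ) : E :=
  f t (x t) (deltaIntegral I (fun s => h t s (x s)) a t)
    (deltaIntegral I (fun s => g t s (x s)) a b)

/-- `x` is a solution on the time scale `I` of the integro-dynamic equation
`x^Δ(t) = f (t, x(t), ∫_a^t h(t, s, x(s)) Δs, ∫_a^b g(t, s, x(s)) Δs)`. As always, the delta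
derivative is not considered at a left-scattered maximum. -/
structure IsSolution (I : Set ℝ) (a b : ℝ) (f : ℝ → E → E → E → E) (h g : ℝ → ℝ → E → E)
    (x : ℝ → E) : Prop where
  rdContinuous : RdContinuous I x
  hasDeltaDerivAt : ∀ t ∈ kappa I, HasDeltaDerivAt I x (volterraFredholm I a b f h g x t) t

end TimeScale

end

namespace TimeScale

variable {E : Type*} [NormedAddCommGroup E] [NormedSpace ℝ E]

/-! Put u = ‖x‖, K₂(t) = ∫_a^t k₂u, C = ∫_a^b k₃u and Z(t) = ∫_a^t k₁(u + K₂ + C). The Lipschitz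
bounds, applied to the right-hand sides at x and at 0, give u ≤ m + Z after integration. Then v = m
+ C + K₂ + Z dominates both u and u + K₂ + C, so v^Δ ≤ (k₁ + k₂)v, and Grönwall gives u ≤ (m + C)e
with e = e_{k₁+k₂}(·, a). Inserting this into C yields C ≤ (m + C)r, that is, m + C ≤ m/(1 - r).

Every comparison and the uniqueness of integrals rest on the mean value inequality
`norm_sub_le_of_norm_deltaDeriv_le`. Existence of integrals is `RdContinuous.exists_antiderivative`:
an rd-continuous function, extended to ℝ as a step function across the gaps, has a Lebesgue
primitive. Grönwall is `le_mul_exp_of_deltaDeriv_le`. -/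

theorem forwardJump_mem {T : Set ℝ} (hT : IsClosed T) {t : ℝ} (ht : t ∈ T) :
    forwardJump T t ∈ T := by
  unfold forwardJump
  split_ifs with h
  · have h1 : sInf (T ∩ Ioi t) ∈ closure (T ∩ Ioi t) :=
      csInf_mem_closure h ⟨t, fun y hy => le_of_lt hy.2⟩
    exact hT.closure_subset_iff.2 inter_subset_left h1
  · exact ht

theorem le_forwardJump (T : Set ℝ) (t : ℝ) : t ≤ forwardJump T t := by
  unfold forwardJump
  split_ifs with h
  · exact le_csInf h fun y hy => le_of_lt hy.2
  · exact le_rfl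

theorem forwardJump_le {T : Set ℝ} {t s : ℝ} (hs : s ∈ T) (hts : t < s) :
    forwardJump T t ≤ s := by
  unfold forwardJump
  rw [if_pos ⟨s, hs, hts⟩]
  exact csInf_le ⟨t, fun y hy => le_of_lt hy.2⟩ ⟨hs, hts⟩

theorem graininess_nonneg (T : Set ℝ) (t : ℝ) : 0 ≤ graininess T t :=
  sub_nonneg.2 (le_forwardJump T t)

theorem graininess_le {T : Set ℝ} {t s : ℝ} (hs : s ∈ T) (hts : t < s) :
    graininess T t ≤ s - t :=
  sub_le_sub_right (forwardJump_le hs hts) t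

/-! ### Calculus of the delta derivative -/

theorem hasDeltaDerivAt_iff_eventually {T : Set ℝ} {F : ℝ → E} {F' : E} {t : ℝ} :
    HasDeltaDerivAt T F F' t ↔ ∀ ε > 0, ∀ᶠ s in 𝓝[T] t,
      ‖(F (forwardJump T t) - F s) - (forwardJump T t - s) • F'‖
        ≤ ε * |forwardJump T t - s| := by
  refine forall₂_congr fun ε _ => ?_
  rw [Filter.Eventually, mem_nhdsWithin_iff_exists_mem_nhds_inter]
  rfl

theorem hasDeltaDerivAt_iff_of_eq {T : Set ℝ} {F : ℝ → E} {F' : E} {t : ℝ}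
    (h : forwardJump T t = t) : HasDeltaDerivAt T F F' t ↔ HasDerivWithinAt F F' T t := by
  rw [hasDeltaDerivAt_iff_eventually, hasDerivWithinAt_iff_isLittleO, Asymptotics.isLittleO_iff, h]
  refine forall₂_congr fun ε _ => eventually_congr (Eventually.of_forall fun s => ?_)
  rw [← norm_neg, Real.norm_eq_abs, abs_sub_comm t s]
  have : -(F t - F s - (t - s) • F') = F s - F t - (s - t) • F' := by
    rw [sub_smul, sub_smul]; abel
  rw [this]

/-- Here |σ(t) - s| stays near σ(t) - t > 0, so the error must tend to 0: at s = t this is the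
difference quotient, as s → t it is continuity. With the case σ(t) = t, it reduces each
differentiation rule to two elementary checks. -/
theorem hasDeltaDerivAt_iff_of_lt {T : Set ℝ} {F : ℝ → E} {F' : E} {t : ℝ} (ht : t ∈ T)
    (h : t < forwardJump T t) :
    HasDeltaDerivAt T F F' t ↔ ContinuousWithinAt F T t ∧
      F (forwardJump T t) - F t = (forwardJump T t - t) • F' := by
  rw [hasDeltaDerivAt_iff_eventually]
  set σ := forwardJump T t
  have hlin : Tendsto (fun s : ℝ => |σ - s|) (𝓝[T] t) (𝓝 (σ - t)) := by
    have : ContinuousAt (fun s : ℝ => |σ - s|) t := by fun_prop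
    have h2 := this.tendsto.mono_left (nhdsWithin_le_nhds (s := T))
    simpa [abs_of_pos (sub_pos.2 h)] using h2
  have hpos : 0 < σ - t := sub_pos.2 h
  constructor
  · intro H
    have heq : (F σ - F t) - (σ - t) • F' = 0 := by
      rw [← norm_le_zero_iff]
      refine le_of_forall_pos_le_add fun ε hε => ?_
      have := (H (ε / (σ - t)) (by positivity)).self_of_nhdsWithin ht
      rw [abs_of_pos hpos, div_mul_cancel₀ _ hpos.ne'] at this
      linarith
    refine ⟨?_, sub_eq_zero.1 heq⟩
    have hG : Tendsto (fun s => (F σ - F s) - (σ - s) • F') (𝓝[T] t) (𝓝 0) := by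
      rw [Metric.tendsto_nhds]
      intro ε hε
      have hc : 0 < ε / (2 * (σ - t)) := by positivity
      filter_upwards [H _ hc, hlin.eventually_lt_const (by linarith : σ - t < 2 * (σ - t))]
        with s h1 h2
      rw [dist_zero_right]
      calc _ ≤ _ := h1
        _ < ε / (2 * (σ - t)) * (2 * (σ - t)) := by gcongr
        _ = ε := by field_simp
    have hs : Tendsto (fun s : ℝ => F σ - (σ - s) • F') (𝓝[T] t) (𝓝 (F σ - (σ - t) • F')) := by
      have : ContinuousAt (fun s : ℝ => F σ - (σ - s) • F') t := by fun_prop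
      exact this.tendsto.mono_left nhdsWithin_le_nhds
    have h3 := hs.sub hG
    have e1 : F σ - (σ - t) • F' - 0 = F t := by
      rw [sub_zero, ← sub_eq_zero.1 heq]; abel
    rw [e1] at h3
    refine h3.congr fun s => ?_
    abel
  · rintro ⟨hc, heq⟩ ε hε
    have hG : Tendsto (fun s => ‖(F σ - F s) - (σ - s) • F'‖) (𝓝[T] t) (𝓝 0) := by
      have h1 : ContinuousWithinAt (fun s => ‖(F σ - F s) - (σ - s) • F'‖) T t := by
        refine ((continuousWithinAt_const.sub hc).sub ?_).norm
        exact ((continuousWithinAt_const.sub continuousWithinAt_id).smul continuousWithinAt_const)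
      have h2 := h1.tendsto
      rwa [heq, sub_self, norm_zero] at h2
    have hc : 0 < ε * ((σ - t) / 2) := by positivity
    filter_upwards [hG.eventually_lt_const hc,
      hlin.eventually_const_lt (by linarith : (σ - t) / 2 < σ - t)] with s h1 h2
    exact h1.le.trans (by gcongr)

theorem HasDeltaDerivAt.continuousWithinAt {T : Set ℝ} {F : ℝ → E} {F' : E} {t : ℝ} (ht : t ∈ T)
    (h : HasDeltaDerivAt T F F' t) : ContinuousWithinAt F T t := by
  rcases (le_forwardJump T t).eq_or_lt with he | hlt
  · exact ((hasDeltaDerivAt_iff_of_eq he.symm).1 h).continuousWithinAt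
  · exact ((hasDeltaDerivAt_iff_of_lt ht hlt).1 h).1

theorem HasDeltaDerivAt.forwardJump_sub {T : Set ℝ} {F : ℝ → E} {F' : E} {t : ℝ} (ht : t ∈ T)
    (h : HasDeltaDerivAt T F F' t) :
    F (forwardJump T t) - F t = (forwardJump T t - t) • F' := by
  rcases (le_forwardJump T t).eq_or_lt with he | hlt
  · rw [← he]; simp
  · exact ((hasDeltaDerivAt_iff_of_lt ht hlt).1 h).2

theorem HasDeltaDerivAt.add {T : Set ℝ} {F G : ℝ → E} {F' G' : E} {t : ℝ} (ht : t ∈ T)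
    (hF : HasDeltaDerivAt T F F' t) (hG : HasDeltaDerivAt T G G' t) :
    HasDeltaDerivAt T (fun s => F s + G s) (F' + G') t := by
  rcases (le_forwardJump T t).eq_or_lt with he | hlt
  · rw [hasDeltaDerivAt_iff_of_eq he.symm] at *
    exact HasDerivWithinAt.add hF hG
  · rw [hasDeltaDerivAt_iff_of_lt ht hlt] at *
    refine ⟨hF.1.add hG.1, ?_⟩
    rw [smul_add, ← hF.2, ← hG.2]; abel

theorem HasDeltaDerivAt.neg {T : Set ℝ} {F : ℝ → E} {F' : E} {t : ℝ} (ht : t ∈ T)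
    (hF : HasDeltaDerivAt T F F' t) : HasDeltaDerivAt T (fun s => -F s) (-F') t := by
  rcases (le_forwardJump T t).eq_or_lt with he | hlt
  · rw [hasDeltaDerivAt_iff_of_eq he.symm] at *
    exact HasDerivWithinAt.neg hF
  · rw [hasDeltaDerivAt_iff_of_lt ht hlt] at *
    refine ⟨hF.1.neg, ?_⟩
    rw [smul_neg, ← hF.2]; abel

theorem HasDeltaDerivAt.sub {T : Set ℝ} {F G : ℝ → E} {F' G' : E} {t : ℝ} (ht : t ∈ T)
    (hF : HasDeltaDerivAt T F F' t) (hG : HasDeltaDerivAt T G G' t) :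
    HasDeltaDerivAt T (fun s => F s - G s) (F' - G') t := by
  simpa only [sub_eq_add_neg] using hF.add ht (hG.neg ht)

theorem hasDeltaDerivAt_const (T : Set ℝ) (c : E) (t : ℝ) :
    HasDeltaDerivAt T (fun _ => c) 0 t := by
  intro ε hε
  refine ⟨univ, univ_mem, fun s _ => ?_⟩
  simp only [sub_self, smul_zero, norm_zero]
  positivity

theorem HasDeltaDerivAt.const_mul {T : Set ℝ} {F : ℝ → ℝ} {F' t : ℝ} (c : ℝ) (ht : t ∈ T)
    (hF : HasDeltaDerivAt T F F' t) : HasDeltaDerivAt T (fun s => c * F s) (c * F') t := by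
  rcases (le_forwardJump T t).eq_or_lt with he | hlt
  · rw [hasDeltaDerivAt_iff_of_eq he.symm] at *
    exact HasDerivWithinAt.const_mul c hF
  · rw [hasDeltaDerivAt_iff_of_lt ht hlt] at *
    refine ⟨continuousWithinAt_const.mul hF.1, ?_⟩
    have := hF.2
    simp only [smul_eq_mul] at *
    linear_combination c * this

/-! ### Mean value inequality and uniqueness of the integral -/

/-- In every neighbourhood of the data of a delta derivative there is a later point of the time
scale at which the increment is approximated by the derivative. -/
theorem exists_gt_norm_sub_le {T : Set ℝ} (hT : IsClosed T) {F : ℝ → E} {F' : E} {V : ℝ → ℝ}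
    {V' c t ε : ℝ} (hc : c ∈ T) (ht : t ∈ T) (hct : c < t) (hF : HasDeltaDerivAt T F F' c)
    (hV : HasDeltaDerivAt T V V' c) (hε : 0 < ε) :
    ∃ s ∈ T, c < s ∧ s ≤ t ∧ ‖F s - F c - (s - c) • F'‖ ≤ ε * (s - c) ∧
      |V s - V c - (s - c) * V'| ≤ ε * (s - c) := by
  rcases (le_forwardJump T c).eq_or_lt with he | hlt
  · have h1 := hasDeltaDerivAt_iff_eventually.1 hF ε hε
    have h2 := hasDeltaDerivAt_iff_eventually.1 hV ε hε
    rw [← he] at h1 h2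
    obtain ⟨U, hU, hUT⟩ := mem_nhdsWithin_iff_exists_mem_nhds_inter.1 (h1.and h2)
    obtain ⟨δ, hδ, hball⟩ := Metric.mem_nhds_iff.1 hU
    have hne : (T ∩ Ioi c).Nonempty := ⟨t, ht, hct⟩
    have hinf : sInf (T ∩ Ioi c) = c := by
      have := he.symm
      unfold forwardJump at this
      rwa [if_pos hne] at this
    obtain ⟨s, ⟨hsT, hsc⟩, hs⟩ := exists_lt_of_csInf_lt hne
      (show sInf (T ∩ Ioi c) < min (c + δ) t by
        rw [hinf]; exact lt_min (by linarith) hct)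
    have hsc : c < s := hsc
    have hsU : s ∈ U := hball (by
      rw [Metric.mem_ball, Real.dist_eq, abs_of_pos (by linarith)]
      linarith [hs.trans_le (min_le_left _ _)])
    obtain ⟨h3, h4⟩ := hUT ⟨hsU, hsT⟩
    refine ⟨s, hsT, hsc, (hs.trans_le (min_le_right _ _)).le, ?_, ?_⟩
    · rw [← norm_neg, abs_sub_comm, abs_of_pos (by linarith)] at h3
      rwa [show F s - F c - (s - c) • F' = -(F c - F s - (c - s) • F') by
        rw [sub_smul, sub_smul]; abel]
    · rw [← norm_neg, abs_sub_comm, abs_of_pos (by linarith)] at h4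
      rwa [← Real.norm_eq_abs, show V s - V c - (s - c) * V' = -(V c - V s - (c - s) • V') by
        rw [smul_eq_mul]; ring]
  · refine ⟨forwardJump T c, forwardJump_mem hT hc, hlt, forwardJump_le ht hct, ?_, ?_⟩
    · rw [hF.forwardJump_sub hc, sub_self, norm_zero]
      exact mul_nonneg hε.le (by linarith)
    · rw [hV.forwardJump_sub hc, smul_eq_mul, sub_self, abs_zero]
      exact mul_nonneg hε.le (by linarith)

/-- The mean value inequality on time scales. -/
theorem norm_sub_le_of_norm_deltaDeriv_le {T : Set ℝ} (hT : IsClosed T) {F F' : ℝ → E}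
    {V V' : ℝ → ℝ} {a t : ℝ} (ha : a ∈ T) (ht : t ∈ T) (hat : a ≤ t)
    (hFc : ContinuousOn F (T ∩ Icc a t)) (hVc : ContinuousOn V (T ∩ Icc a t))
    (hF : ∀ s ∈ T ∩ Ico a t, HasDeltaDerivAt T F (F' s) s)
    (hV : ∀ s ∈ T ∩ Ico a t, HasDeltaDerivAt T V (V' s) s)
    (hle : ∀ s ∈ T ∩ Ico a t, ‖F' s‖ ≤ V' s) :
    ‖F t - F a‖ ≤ V t - V a := by
  suffices H : ∀ ε > 0, ‖F t - F a‖ ≤ V t - V a + ε * (t - a) by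
    have hlim : Tendsto (fun ε : ℝ => V t - V a + ε * (t - a)) (𝓝[>] 0)
        (𝓝 (V t - V a + 0 * (t - a))) :=
      (Continuous.tendsto (by fun_prop) 0).mono_left nhdsWithin_le_nhds
    rw [zero_mul, add_zero] at hlim
    exact ge_of_tendsto hlim (eventually_mem_nhdsWithin.mono H)
  intro ε hε
  have hKc : IsClosed (T ∩ Icc a t) := hT.inter isClosed_Icc
  -- The points where the inequality relaxed by ε holds form a compact set. Its maximum must be t,
  -- since from any earlier point one can advance within T, either to a nearby point or across a
  -- gap.
  set A : Set ℝ := (T ∩ Icc a t) ∩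
    (fun s => ‖F s - F a‖ - (V s - V a + ε * (s - a))) ⁻¹' Iic 0 with hA
  have hAcl : IsClosed A := by
    refine ContinuousOn.preimage_isClosed_of_isClosed ?_ hKc isClosed_Iic
    exact (hFc.sub continuousOn_const).norm.sub
      ((hVc.sub continuousOn_const).add (by fun_prop))
  have hAcomp : IsCompact A :=
    isCompact_Icc.of_isClosed_subset hAcl fun s hs => hs.1.2
  have haA : a ∈ A := ⟨⟨ha, le_rfl, hat⟩, by simp⟩
  obtain ⟨c, hcA, hcmax⟩ := hAcomp.exists_isGreatest ⟨a, haA⟩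
  obtain ⟨⟨hcT, hac, hct⟩, hcle⟩ := hcA
  have hcle : ‖F c - F a‖ - (V c - V a + ε * (c - a)) ≤ 0 := hcle
  rcases hct.eq_or_lt with rfl | hlt
  · linarith
  exfalso
  have hmem : c ∈ T ∩ Ico a t := ⟨hcT, hac, hlt⟩
  -- One half of ε pays for the error of F, the other for that of V.
  obtain ⟨s, hsT, hcs, hst, h1, h2⟩ := exists_gt_norm_sub_le hT hcT ht hlt (hF c hmem)
    (hV c hmem) (half_pos hε)
  refine absurd (hcmax (a := s) ⟨⟨hsT, hac.trans hcs.le, hst⟩, ?_⟩) (not_le.2 hcs)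
  have h3 : ‖F s - F a‖ ≤ ‖F s - F c - (s - c) • F' c‖ + ‖(s - c) • F' c‖ + ‖F c - F a‖ := by
    have : F s - F a = (F s - F c - (s - c) • F' c) + (s - c) • F' c + (F c - F a) := by abel
    rw [this]
    exact norm_add₃_le
  have hsc : 0 < s - c := by linarith
  rw [norm_smul, Real.norm_eq_abs, abs_of_pos hsc] at h3
  have h4 := mul_le_mul_of_nonneg_left (hle c hmem) hsc.le
  have h5 := (abs_le.1 h2).1
  change ‖F s - F a‖ - (V s - V a + ε * (s - a)) ≤ 0
  linarith

theorem le_of_deltaDeriv_nonpos {T : Set ℝ} (hT : IsClosed T) {V V' : ℝ → ℝ} {a t : ℝ}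
    (ha : a ∈ T) (ht : t ∈ T) (hat : a ≤ t) (hVc : ContinuousOn V (T ∩ Icc a t))
    (hV : ∀ s ∈ T ∩ Ico a t, HasDeltaDerivAt T V (V' s) s)
    (hle : ∀ s ∈ T ∩ Ico a t, V' s ≤ 0) : V t ≤ V a := by
  have := norm_sub_le_of_norm_deltaDeriv_le hT ha ht hat (F := fun _ => (0 : ℝ))
    (F' := fun _ => 0) (V := fun s => -V s) (V' := fun s => -V' s)
    continuousOn_const hVc.neg (fun s _ => hasDeltaDerivAt_const T 0 s)
    (fun s hs => (hV s hs).neg hs.1) (fun s hs => by simpa using hle s hs)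
  simp only [sub_self, norm_zero] at this
  linarith

/-- The delta integral can be computed from any antiderivative. -/
theorem deltaIntegral_eq_sub {T : Set ℝ} (hT : IsClosed T) {F f : ℝ → E} {a t : ℝ}
    (ha : a ∈ T) (ht : t ∈ T) (hat : a ≤ t) (hF : IsAntiderivativeOn T F f a t) :
    deltaIntegral T f a t = F t - F a := by
  have hint : DeltaIntegrable T f a t := ⟨F, by rwa [min_eq_left hat, max_eq_right hat]⟩
  unfold deltaIntegral
  rw [dif_pos hint]
  have hG := hint.choose_spec
  set G := hint.choose
  rw [min_eq_left hat, max_eq_right hat] at hG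
  -- The chosen antiderivative minus F has derivative 0, so the majorant 0 shows that it is
  -- constant.
  have h := norm_sub_le_of_norm_deltaDeriv_le hT ha ht hat (F := fun s => G s - F s)
    (F' := fun s => f s - f s) (V := fun _ => 0) (V' := fun _ => 0)
    (hG.1.sub hF.1) continuousOn_const (fun s hs => (hG.2 s hs).sub hs.1 (hF.2 s hs))
    (fun s _ => hasDeltaDerivAt_const T 0 s) (fun s _ => by simp)
  have h0 : G t - F t - (G a - F a) = 0 := by
    rw [← norm_le_zero_iff]; simpa using h
  rw [← sub_eq_zero, ← h0]; abel

end TimeScale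

/-! ### Antiderivatives of rd-continuous functions -/

namespace TimeScale

open MeasureTheory in
-- Sampling g at the first point of the grid ℤ/(n + 1) strictly to the right of x gives step
-- functions; they converge pointwise by right continuity.
theorem stronglyMeasurable_of_continuousWithinAt_Ici {E : Type*} [TopologicalSpace E]
    [TopologicalSpace.PseudoMetrizableSpace E] {g : ℝ → E}
    (hg : ∀ x, ContinuousWithinAt g (Ici x) x) : StronglyMeasurable g := by
  have hm : ∀ n : ℕ, StronglyMeasurable fun x : ℝ => g ((⌊(n + 1 : ℝ) * x⌋ + 1 : ℝ) / (n + 1)) :=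
    fun n => (StronglyMeasurable.of_discrete
      (f := fun k : ℤ => g ((k + 1 : ℝ) / (n + 1)))).comp_measurable
        (Int.measurable_floor.comp (measurable_const_mul (n + 1 : ℝ)))
  refine stronglyMeasurable_of_tendsto atTop hm (tendsto_pi_nhds.2 fun x => ?_)
  refine (hg x).tendsto.comp (tendsto_nhdsWithin_iff.2 ⟨?_, Eventually.of_forall fun n => ?_⟩)
  · have h1 : Tendsto (fun n : ℕ => x + 1 / ((n : ℝ) + 1)) atTop (𝓝 (x + 0)) :=
      tendsto_const_nhds.add tendsto_one_div_add_atTop_nhds_zero_nat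
    rw [add_zero] at h1
    refine tendsto_of_tendsto_of_tendsto_of_le_of_le tendsto_const_nhds h1 (fun n => ?_)
      fun n => ?_
    · have hn : (0 : ℝ) < n + 1 := by positivity
      show x ≤ _ / _
      rw [le_div_iff₀ hn]
      nlinarith [Int.lt_floor_add_one ((n + 1 : ℝ) * x)]
    · have hn : (0 : ℝ) < n + 1 := by positivity
      show _ / _ ≤ x + _
      rw [div_le_iff₀ hn, add_mul x, one_div, inv_mul_cancel₀ hn.ne']
      nlinarith [Int.floor_le ((n + 1 : ℝ) * x)]
  · have hn : (0 : ℝ) < n + 1 := by positivity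
    show x ≤ _ / _
    rw [le_div_iff₀ hn]
    nlinarith [Int.lt_floor_add_one ((n + 1 : ℝ) * x)]

open MeasureTheory in
theorem locallyIntegrable_of_one_sided_limits {E : Type*} [NormedAddCommGroup E] {g : ℝ → E}
    (hr : ∀ x, ContinuousWithinAt g (Ici x) x) (hl : ∀ x, ∃ l, Tendsto g (𝓝[<] x) (𝓝 l)) :
    LocallyIntegrable g volume := by
  have hm := stronglyMeasurable_of_continuousWithinAt_Ici hr
  intro x
  rw [← nhdsLT_sup_nhdsGE, IntegrableAtFilter.sup_iff]
  obtain ⟨l, hl⟩ := hl x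
  exact ⟨hl.integrableAtFilter hm.aestronglyMeasurable.stronglyMeasurableAtFilter
      (volume.finiteAt_nhdsWithin _ _),
    (hr x).tendsto.integrableAtFilter hm.aestronglyMeasurable.stronglyMeasurableAtFilter
      (volume.finiteAt_nhdsWithin _ _)⟩

/-- The last point of `T` that is at most `x`, or `a` (for `a = min T`) if there is none. -/
noncomputable def lastPoint (T : Set ℝ) (a x : ℝ) : ℝ := sSup (T ∩ Iic (max x a))

section LastPoint

variable {T : Set ℝ} {a : ℝ}

theorem lastPoint_mem (hT : IsClosed T) (ha : a ∈ T) (x : ℝ) : lastPoint T a x ∈ T := by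
  have h : lastPoint T a x ∈ closure (T ∩ Iic (max x a)) :=
    csSup_mem_closure ⟨a, ha, le_max_right x a⟩ ⟨max x a, fun y hy => hy.2⟩
  exact hT.closure_subset_iff.2 inter_subset_left h

theorem lastPoint_le (ha : a ∈ T) {x : ℝ} (hx : a ≤ x) : lastPoint T a x ≤ x := by
  refine csSup_le ⟨a, ha, le_max_right x a⟩ fun y hy => ?_
  have : y ≤ max x a := hy.2
  rwa [max_eq_left hx] at this

theorem le_lastPoint {s x : ℝ} (hs : s ∈ T) (hsx : s ≤ x) : s ≤ lastPoint T a x :=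
  le_csSup ⟨max x a, fun _ hy => hy.2⟩ ⟨hs, hsx.trans (le_max_left x a)⟩

theorem lastPoint_of_mem (ha : IsLeast T a) {t : ℝ} (ht : t ∈ T) : lastPoint T a t = t :=
  le_antisymm (lastPoint_le ha.1 (ha.2 ht)) (le_lastPoint ht le_rfl)

theorem lastPoint_eq_of_inter_eq_empty {x y : ℝ} (hxy : x ≤ y) (h : T ∩ Ioc x y = ∅) :
    lastPoint T a y = lastPoint T a x := by
  unfold lastPoint
  congr 1
  ext s
  refine and_congr_right fun hs => ⟨fun hsy => ?_, fun hsx => ?_⟩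
  · rcases le_max_iff.1 (mem_Iic.1 hsy) with h1 | h1
    · have : s ≤ x := by
        by_contra hc
        exact notMem_empty s (h ▸ ⟨hs, not_le.1 hc, h1⟩)
      exact this.trans (le_max_left x a)
    · exact h1.trans (le_max_right x a)
  · exact (mem_Iic.1 hsx).trans (max_le_max_right a hxy)

/-- One half of a dichotomy at an arbitrary real x: either T accumulates at x from the right, or
there is a gap on which `lastPoint` is constant. -/
theorem rightDense_of_forall_exists (hT : IsClosed T) {x : ℝ}
    (h : ∀ δ > x, (T ∩ Ioc x δ).Nonempty) : x ∈ T ∧ RightDense T x := by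
  have hx : x ∈ T := by
    refine hT.closure_subset (Metric.mem_closure_iff.2 fun ε hε => ?_)
    obtain ⟨s, hs, h1, h2⟩ := h (x + ε / 2) (by linarith)
    refine ⟨s, hs, ?_⟩
    rw [dist_comm, Real.dist_eq, abs_of_pos (by linarith)]
    linarith
  refine ⟨hx, ?_, le_antisymm (le_of_forall_gt fun δ hδ => ?_) (le_forwardJump T x)⟩
  · obtain ⟨s, hs, h1, -⟩ := h (x + 1) (by linarith)
    exact ⟨s, hs, h1⟩
  · obtain ⟨s, hs, h1, h2⟩ := h ((x + δ) / 2) (by linarith)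
    exact (forwardJump_le hs h1).trans_lt (by linarith)

theorem leftDense_of_forall_exists (hT : IsClosed T) {x : ℝ}
    (h : ∀ δ < x, (T ∩ Ioo δ x).Nonempty) : x ∈ T ∧ LeftDense T x := by
  have hx : x ∈ T := by
    refine hT.closure_subset (Metric.mem_closure_iff.2 fun ε hε => ?_)
    obtain ⟨s, hs, h1, h2⟩ := h (x - ε) (by linarith)
    refine ⟨s, hs, ?_⟩
    rw [Real.dist_eq, abs_of_pos (by linarith)]
    linarith
  have hne : (T ∩ Iio x).Nonempty := by
    obtain ⟨s, hs, -, h2⟩ := h (x - 1) (by linarith)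
    exact ⟨s, hs, h2⟩
  refine ⟨hx, hne, ?_⟩
  unfold backwardJump
  rw [if_pos hne]
  refine le_antisymm (csSup_le hne fun y hy => le_of_lt hy.2) (le_of_forall_lt fun δ hδ => ?_)
  obtain ⟨s, hs, h1, h2⟩ := h δ hδ
  exact h1.trans_le (le_csSup ⟨x, fun y hy => le_of_lt hy.2⟩ ⟨hs, h2⟩)

theorem tendsto_lastPoint_nhdsGE (hT : IsClosed T) (ha : IsLeast T a) {x : ℝ} (hx : x ∈ T) :
    Tendsto (lastPoint T a) (𝓝[≥] x) (𝓝[T] x) := by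
  refine tendsto_nhdsWithin_iff.2 ⟨?_, Eventually.of_forall (lastPoint_mem hT ha.1)⟩
  refine tendsto_of_tendsto_of_tendsto_of_le_of_le' tendsto_const_nhds
    (tendsto_id.mono_left nhdsWithin_le_nhds) ?_ ?_
  · filter_upwards [self_mem_nhdsWithin] with y hy using le_lastPoint hx hy
  · filter_upwards [self_mem_nhdsWithin] with y hy using
      lastPoint_le ha.1 ((ha.2 hx).trans hy)

/-- The values stay strictly below x, which is needed because rd-continuity only provides a limit
along `T ∩ Iio x`. -/
theorem tendsto_lastPoint_nhdsLT (hT : IsClosed T) (ha : IsLeast T a) {x : ℝ}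
    (h : ∀ δ < x, (T ∩ Ioo δ x).Nonempty) :
    Tendsto (lastPoint T a) (𝓝[<] x) (𝓝[T ∩ Iio x] x) := by
  obtain ⟨s₀, hs₀, -, hs₀x⟩ := h (x - 1) (by linarith)
  have hax : a < x := (ha.2 hs₀).trans_lt hs₀x
  have hlt : ∀ᶠ y in 𝓝[<] x, lastPoint T a y < x := by
    filter_upwards [self_mem_nhdsWithin, mem_nhdsWithin_of_mem_nhds (Ioi_mem_nhds hax)]
      with y hy hay using (lastPoint_le ha.1 (le_of_lt hay)).trans_lt hy
  refine tendsto_nhdsWithin_iff.2 ⟨?_, hlt.mono fun y hy => ⟨lastPoint_mem hT ha.1 y, hy⟩⟩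
  refine tendsto_order.2 ⟨fun δ hδ => ?_, fun δ hδ => hlt.mono fun y hy => hy.trans hδ⟩
  obtain ⟨s, hs, h1, h2⟩ := h δ hδ
  filter_upwards [mem_nhdsWithin_of_mem_nhds (Ioi_mem_nhds h2)] with y hy
    using h1.trans_le (le_lastPoint hs (le_of_lt hy))

variable {E : Type*} [NormedAddCommGroup E] {f : ℝ → E}

theorem RdContinuous.continuousWithinAt_comp_lastPoint (hT : IsClosed T) (ha : IsLeast T a)
    (hf : RdContinuous T f) (x : ℝ) :
    ContinuousWithinAt (fun y => f (lastPoint T a y)) (Ici x) x := by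
  by_cases h : ∀ δ > x, (T ∩ Ioc x δ).Nonempty
  · obtain ⟨hx, hd⟩ := rightDense_of_forall_exists hT h
    have h1 := (hf.1 x hx hd).tendsto.comp (tendsto_lastPoint_nhdsGE hT ha hx)
    unfold ContinuousWithinAt
    simp only [lastPoint_of_mem ha hx]
    exact h1
  · push Not at h
    obtain ⟨δ, hδ, hemp⟩ := h
    refine ContinuousWithinAt.congr_of_eventuallyEq
      (continuousWithinAt_const (b := f (lastPoint T a x))) ?_ rfl
    filter_upwards [self_mem_nhdsWithin, mem_nhdsWithin_of_mem_nhds (Iio_mem_nhds hδ)]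
      with y hy hyδ
    rw [lastPoint_eq_of_inter_eq_empty hy]
    exact subset_eq_empty (inter_subset_inter_right T (Ioc_subset_Ioc_right (le_of_lt hyδ))) hemp

theorem RdContinuous.exists_tendsto_comp_lastPoint (hT : IsClosed T) (ha : IsLeast T a)
    (hf : RdContinuous T f) (x : ℝ) :
    ∃ l, Tendsto (fun y => f (lastPoint T a y)) (𝓝[<] x) (𝓝 l) := by
  by_cases h : ∀ δ < x, (T ∩ Ioo δ x).Nonempty
  · obtain ⟨hx, hd⟩ := leftDense_of_forall_exists hT h
    obtain ⟨l, hl⟩ := hf.2 x hx hd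
    exact ⟨l, hl.comp (tendsto_lastPoint_nhdsLT hT ha h)⟩
  · push Not at h
    obtain ⟨δ, hδ, hemp⟩ := h
    refine ⟨f (lastPoint T a δ), Tendsto.congr' ?_ tendsto_const_nhds⟩
    filter_upwards [self_mem_nhdsWithin, mem_nhdsWithin_of_mem_nhds (Ioi_mem_nhds hδ)]
      with y hy hyδ
    rw [lastPoint_eq_of_inter_eq_empty (le_of_lt hyδ)]
    refine eq_empty_of_forall_notMem fun z hz => notMem_empty z ?_
    rw [← hemp]
    exact ⟨hz.1, hz.2.1, hz.2.2.trans_lt hy⟩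

/-- Rd-continuous functions have antiderivatives. -/
theorem RdContinuous.exists_antiderivative [NormedSpace ℝ E] [CompleteSpace E] (hT : IsClosed T)
    (ha : IsLeast T a) (hf : RdContinuous T f) :
    ∃ F : ℝ → E, F a = 0 ∧ Continuous F ∧
      ∀ t ∈ T, (T ∩ Ioi t).Nonempty → HasDeltaDerivAt T F (f t) t := by
  set g : ℝ → E := fun y => f (lastPoint T a y) with hg
  have hr := hf.continuousWithinAt_comp_lastPoint hT ha
  have hm := stronglyMeasurable_of_continuousWithinAt_Ici hr
  have hloc := locallyIntegrable_of_one_sided_limits hr (hf.exists_tendsto_comp_lastPoint hT ha)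
  have hint : ∀ u v, IntervalIntegrable g MeasureTheory.volume u v := fun u v =>
    (hloc.integrableOn_isCompact isCompact_uIcc).intervalIntegrable
  have hcont := intervalIntegral.continuous_primitive hint a
  refine ⟨fun t => ∫ y in a..t, g y, intervalIntegral.integral_same, hcont, fun t ht hne => ?_⟩
  have hgt : g t = f t := by rw [hg]; simp only [lastPoint_of_mem ha ht]
  rcases (le_forwardJump T t).eq_or_lt with he | hlt
  · rw [hasDeltaDerivAt_iff_of_eq he.symm]
    have hright : HasDerivWithinAt (fun t => ∫ y in a..t, g y) (f t) (Ici t) t := by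
      rw [← hgt]
      exact intervalIntegral.integral_hasDerivWithinAt_right (hint a t) (t := Ioi t)
        hm.aestronglyMeasurable.stronglyMeasurableAtFilter ((hr t).mono Ioi_subset_Ici_self)
    -- If T accumulates at t from the left, continuity of f at the right-dense point t gives the
    -- left derivative as well; otherwise T has a gap there and the right derivative suffices. A
    -- left-dense maximum, where f may be discontinuous, is excluded by `hne`.
    by_cases h : ∀ δ < t, (T ∩ Ioo δ t).Nonempty
    · have hleft : HasDerivWithinAt (fun t => ∫ y in a..t, g y) (f t) (Iic t) t := by
        have hfc := hf.1 t ht ⟨hne, he.symm⟩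
        have h1 : ContinuousWithinAt g (Iio t) t := by
          unfold ContinuousWithinAt
          rw [hgt]
          exact (hfc.mono inter_subset_left).tendsto.comp (tendsto_lastPoint_nhdsLT hT ha h)
        rw [← hgt]
        exact intervalIntegral.integral_hasDerivWithinAt_right (hint a t) (t := Iic t)
          hm.aestronglyMeasurable.stronglyMeasurableAtFilter (continuousWithinAt_Iio_iff_Iic.1 h1)
      exact (hleft.union hright).mono fun s _ => le_total s t
    · push Not at h
      obtain ⟨δ, hδ, hemp⟩ := h
      refine hright.mono_of_mem_nhdsWithin ?_
      filter_upwards [self_mem_nhdsWithin, mem_nhdsWithin_of_mem_nhds (Ioi_mem_nhds hδ)]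
        with s hs hsδ
      by_contra hc
      exact notMem_empty s (hemp ▸ ⟨hs, hsδ, not_le.1 hc⟩)
  · rw [hasDeltaDerivAt_iff_of_lt ht hlt]
    refine ⟨hcont.continuousWithinAt, ?_⟩
    -- The extended function equals f(t) on [t, σ(t)); the endpoint σ(t), where it may jump, is a
    -- null set.
    rw [intervalIntegral.integral_interval_sub_left (hint _ _) (hint _ _),
      ← intervalIntegral.integral_const]
    refine intervalIntegral.integral_congr_ae_restrict ?_
    rw [uIoc_of_le hlt.le, ← MeasureTheory.restrict_Ioo_eq_restrict_Ioc]
    refine (MeasureTheory.ae_restrict_mem measurableSet_Ioo).mono fun y hy => ?_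
    simp only [hg]
    rw [lastPoint_eq_of_inter_eq_empty hy.1.le, lastPoint_of_mem ha ht]
    refine eq_empty_of_forall_notMem fun s hs => ?_
    exact absurd (forwardJump_le hs.1 hs.2.1) (not_le.2 (hs.2.2.trans_lt hy.2))

end LastPoint

end TimeScale

namespace TimeScale

/-! ### Stability of rd-continuity -/

section RdContinuous

variable {E : Type*} [NormedAddCommGroup E] {T : Set ℝ}

theorem _root_.ContinuousOn.rdContinuous {f : ℝ → E} (hf : ContinuousOn f T) : RdContinuous T f :=
  ⟨fun t ht _ => hf t ht, fun t ht _ => ⟨f t, ((hf t ht).mono inter_subset_left).tendsto⟩⟩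

theorem RdContinuous.add {f g : ℝ → E} (hf : RdContinuous T f) (hg : RdContinuous T g) :
    RdContinuous T fun t => f t + g t := by
  refine ⟨fun t ht hd => (hf.1 t ht hd).add (hg.1 t ht hd), fun t ht hd => ?_⟩
  obtain ⟨l, hl⟩ := hf.2 t ht hd
  obtain ⟨l', hl'⟩ := hg.2 t ht hd
  exact ⟨l + l', hl.add hl'⟩

theorem RdContinuous.mul {f g : ℝ → ℝ} (hf : RdContinuous T f) (hg : RdContinuous T g) :
    RdContinuous T fun t => f t * g t := by
  refine ⟨fun t ht hd => (hf.1 t ht hd).mul (hg.1 t ht hd), fun t ht hd => ?_⟩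
  obtain ⟨l, hl⟩ := hf.2 t ht hd
  obtain ⟨l', hl'⟩ := hg.2 t ht hd
  exact ⟨l * l', hl.mul hl'⟩

/-- Composition of a function that is rd-continuous in its first and Lipschitz in its second
variable with a continuous function. -/
theorem RdContinuous.comp_of_lipschitz {φ : ℝ → E → E} {K : ℝ → ℝ} {x : ℝ → E}
    (hφ : ∀ v, RdContinuous T fun s => φ s v) (hK : RdContinuous T K)
    (hLip : ∀ s ∈ T, ∀ v v', ‖φ s v - φ s v'‖ ≤ K s * ‖v - v'‖) (hx : ContinuousOn x T) :
    RdContinuous T fun s => φ s (x s) := by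
  -- Freezing the second variable at x(t) costs at most K(s)‖x(s) - x(t)‖, which tends to 0 because
  -- K has a finite limit.
  have key : ∀ t ∈ T, ∀ (S : Set ℝ) (k : ℝ) (l : E), S ⊆ T → Tendsto K (𝓝[S] t) (𝓝 k) →
      Tendsto (fun s => φ s (x t)) (𝓝[S] t) (𝓝 l) →
      Tendsto (fun s => φ s (x s)) (𝓝[S] t) (𝓝 l) := by
    intro t ht S k l hS hk hl
    have hxt : Tendsto (fun s => ‖x s - x t‖) (𝓝[S] t) (𝓝 0) := by
      have h1 : ContinuousWithinAt (fun s => ‖x s - x t‖) S t :=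
        (((hx t ht).mono hS).sub continuousWithinAt_const).norm
      simpa using h1.tendsto
    have hprod := hk.mul hxt
    rw [mul_zero] at hprod
    have hdiff : Tendsto (fun s => φ s (x s) - φ s (x t)) (𝓝[S] t) (𝓝 0) := by
      refine squeeze_zero_norm' ?_ hprod
      filter_upwards [self_mem_nhdsWithin] with s hs using hLip s (hS hs) _ _
    simpa using hdiff.add hl
  refine ⟨fun t ht hd => ?_, fun t ht hd => ?_⟩
  · exact key t ht T _ _ subset_rfl (hK.1 t ht hd) ((hφ (x t)).1 t ht hd)
  · obtain ⟨k, hk⟩ := hK.2 t ht hd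
    obtain ⟨l, hl⟩ := (hφ (x t)).2 t ht hd
    exact ⟨l, key t ht _ k l inter_subset_left hk hl⟩

theorem tendsto_graininess_of_rightDense {t : ℝ} (hd : RightDense T t) :
    Tendsto (graininess T) (𝓝[T] t) (𝓝 0) := by
  refine tendsto_order.2 ⟨fun δ hδ => Eventually.of_forall fun s =>
    hδ.trans_le (graininess_nonneg T s), fun δ hδ => ?_⟩
  have hinf : sInf (T ∩ Ioi t) = t := by
    have := hd.2
    unfold forwardJump at this
    rwa [if_pos hd.1] at this
  obtain ⟨s₀, ⟨hs₀, hts₀⟩, hlt⟩ := exists_lt_of_csInf_lt hd.1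
    (show sInf (T ∩ Ioi t) < t + δ / 2 by rw [hinf]; linarith)
  filter_upwards [mem_nhdsWithin_of_mem_nhds (Iio_mem_nhds hts₀),
    mem_nhdsWithin_of_mem_nhds (Ioi_mem_nhds (show t - δ / 2 < t by linarith))] with s h1 h2
  have h2 : t - δ / 2 < s := h2
  linarith [graininess_le hs₀ h1]

theorem tendsto_graininess_of_mem {t : ℝ} (ht : t ∈ T) :
    Tendsto (graininess T) (𝓝[T ∩ Iio t] t) (𝓝 0) := by
  refine tendsto_order.2 ⟨fun δ hδ => Eventually.of_forall fun s =>
    hδ.trans_le (graininess_nonneg T s), fun δ hδ => ?_⟩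
  filter_upwards [self_mem_nhdsWithin,
    mem_nhdsWithin_of_mem_nhds (Ioi_mem_nhds (show t - δ < t by linarith))] with s h1 h2
  have h2 : t - δ < s := h2
  linarith [graininess_le ht h1.2]

/-- From 1 - 1/y ≤ log y ≤ y - 1 at y = 1 + hz. At dense points, where the graininess tends to 0,
the cylinder transformation of p thus has the same limits as p. -/
theorem abs_cylinder_sub_le {h z : ℝ} (hh : 0 ≤ h) (hz : 0 ≤ z) :
    |cylinder h z - z| ≤ h * z ^ 2 := by
  unfold cylinder
  split_ifs with h0
  · simp [h0]
  have hpos : 0 < h := lt_of_le_of_ne hh (Ne.symm h0)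
  have hy : 0 < 1 + h * z := by positivity
  have hup := Real.log_le_sub_one_of_pos hy
  have hlow := Real.one_sub_inv_le_log_of_pos hy
  have hinv : (1 + h * z)⁻¹ ≤ 1 - h * z + (h * z) ^ 2 := by
    rw [inv_le_iff_one_le_mul₀ hy]
    have : 0 ≤ (h * z) ^ 3 := by positivity
    nlinarith
  rw [abs_le]
  constructor
  · rw [le_sub_iff_add_le, le_div_iff₀ hpos]
    nlinarith
  · have : Real.log (1 + h * z) / h ≤ z := by
      rw [div_le_iff₀ hpos]; linarith
    have h2 : 0 ≤ h * z ^ 2 := by positivity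
    linarith

theorem RdContinuous.cylinder {p : ℝ → ℝ} (hp : RdContinuous T p) (hp0 : ∀ t ∈ T, 0 ≤ p t) :
    RdContinuous T fun t => cylinder (graininess T t) (p t) := by
  have key : ∀ (t l : ℝ) (S : Set ℝ), S ⊆ T → Tendsto (graininess T) (𝓝[S] t) (𝓝 0) →
      Tendsto p (𝓝[S] t) (𝓝 l) →
      Tendsto (fun t => TimeScale.cylinder (graininess T t) (p t)) (𝓝[S] t) (𝓝 l) := by
    intro t l S hS hμ hl
    have hprod := hμ.mul (hl.pow 2)
    rw [zero_mul] at hprod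
    have hdiff : Tendsto (fun s => TimeScale.cylinder (graininess T s) (p s) - p s)
        (𝓝[S] t) (𝓝 0) := by
      refine squeeze_zero_norm' ?_ hprod
      filter_upwards [self_mem_nhdsWithin] with s hs
        using abs_cylinder_sub_le (graininess_nonneg T s) (hp0 s (hS hs))
    simpa using hdiff.add hl
  refine ⟨fun t ht hd => ?_, fun t ht hd => ?_⟩
  · have hμ : graininess T t = 0 := sub_eq_zero.2 hd.2
    have h1 := key t (p t) T subset_rfl (tendsto_graininess_of_rightDense hd) (hp.1 t ht hd)
    unfold ContinuousWithinAt
    have h2 : TimeScale.cylinder (graininess T t) (p t) = p t := by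
      rw [hμ]; exact if_pos rfl
    simp only [h2]
    exact h1
  · obtain ⟨l, hl⟩ := hp.2 t ht hd
    exact ⟨l, key t l _ inter_subset_left (tendsto_graininess_of_mem ht) hl⟩

end RdContinuous

/-! ### Integral comparison and Grönwall's inequality -/

section Integral

variable {E : Type*} [NormedAddCommGroup E] [NormedSpace ℝ E] {T : Set ℝ} {a : ℝ}

theorem RdContinuous.exists_deltaIntegral_eq [CompleteSpace E] (hT : IsClosed T)
    (ha : IsLeast T a) {f : ℝ → E} (hf : RdContinuous T f) :
    ∃ F : ℝ → E, F a = 0 ∧ Continuous F ∧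
      (∀ t ∈ T, (T ∩ Ioi t).Nonempty → HasDeltaDerivAt T F (f t) t) ∧
      ∀ t ∈ T, deltaIntegral T f a t = F t := by
  obtain ⟨F, hF0, hFc, hF⟩ := hf.exists_antiderivative hT ha
  refine ⟨F, hF0, hFc, hF, fun t ht => ?_⟩
  rw [deltaIntegral_eq_sub hT ha.1 ht (ha.2 ht)
    ⟨hFc.continuousOn, fun s hs => hF s hs.1 ⟨t, ht, hs.2.2⟩⟩, hF0, sub_zero]

theorem norm_deltaIntegral_sub_le [CompleteSpace E] (hT : IsClosed T) (ha : IsLeast T a)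
    {f g : ℝ → E} (hf : RdContinuous T f) (hg : RdContinuous T g) {φ Φ : ℝ → ℝ}
    (hΦ0 : Φ a = 0) (hΦc : Continuous Φ)
    (hΦ : ∀ t ∈ T, (T ∩ Ioi t).Nonempty → HasDeltaDerivAt T Φ (φ t) t)
    (hle : ∀ t ∈ T, ‖f t - g t‖ ≤ φ t) {t : ℝ} (ht : t ∈ T) :
    ‖deltaIntegral T f a t - deltaIntegral T g a t‖ ≤ Φ t := by
  obtain ⟨F, hF0, hFc, hF, hFt⟩ := hf.exists_deltaIntegral_eq hT ha
  obtain ⟨G, hG0, hGc, hG, hGt⟩ := hg.exists_deltaIntegral_eq hT ha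
  have := norm_sub_le_of_norm_deltaDeriv_le hT ha.1 ht (ha.2 ht) (F := fun s => F s - G s)
    (F' := fun s => f s - g s) (V := Φ) (V' := φ) (hFc.sub hGc).continuousOn hΦc.continuousOn
    (fun s hs => (hF s hs.1 ⟨t, ht, hs.2.2⟩).sub hs.1 (hG s hs.1 ⟨t, ht, hs.2.2⟩))
    (fun s hs => hΦ s hs.1 ⟨t, ht, hs.2.2⟩) (fun s hs => hle s hs.1)
  rw [hFt t ht, hGt t ht]
  simpa [hF0, hG0, hΦ0] using this

/-- Grönwall's inequality in differential form. -/
theorem le_mul_exp_of_deltaDeriv_le (hT : IsClosed T) (ha : IsLeast T a) {p F V V' : ℝ → ℝ}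
    (hp : ∀ t ∈ T, 0 ≤ p t) (hF0 : F a = 0) (hFc : Continuous F)
    (hF : ∀ t ∈ T, (T ∩ Ioi t).Nonempty →
      HasDeltaDerivAt T F (cylinder (graininess T t) (p t)) t)
    (hVc : Continuous V)
    (hV : ∀ t ∈ T, (T ∩ Ioi t).Nonempty → HasDeltaDerivAt T V (V' t) t)
    (hle : ∀ t ∈ T, (T ∩ Ioi t).Nonempty → V' t ≤ p t * V t) {t : ℝ} (ht : t ∈ T) :
    V t ≤ V a * Real.exp (F t) := by
  -- The integrating factor exp(-F) makes the derivative a nonpositive multiple of a positive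
  -- number.
  have hQ : ∀ s ∈ T ∩ Ico a t, HasDeltaDerivAt T (fun s => V s * Real.exp (-F s))
      ((V' s - p s * V s) * Real.exp (-F (forwardJump T s))) s := by
    rintro s ⟨hs, hst⟩
    have hFs := hF s hs ⟨t, ht, hst.2⟩
    have hVs := hV s hs ⟨t, ht, hst.2⟩
    rcases (le_forwardJump T s).eq_or_lt with he | hlt
    · have hμ : graininess T s = 0 := sub_eq_zero.2 he.symm
      rw [hasDeltaDerivAt_iff_of_eq he.symm] at *
      rw [hμ, cylinder, if_pos rfl] at hFs
      rw [← he]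
      refine (hVs.mul hFs.neg.exp).congr_deriv ?_
      simp only [Pi.neg_apply]
      ring
    · have hμ : 0 < graininess T s := sub_pos.2 hlt
      have hpos : 0 < 1 + graininess T s * p s := by have := hp s hs; positivity
      rw [hasDeltaDerivAt_iff_of_lt hs hlt] at *
      refine ⟨hVs.1.mul hFs.1.neg.rexp, ?_⟩
      have h1 := hVs.2
      have h2 := hFs.2
      change _ = graininess T s • _ at h1 h2
      change _ = graininess T s • _
      rw [cylinder, if_neg hμ.ne', smul_eq_mul, mul_div_cancel₀ _ hμ.ne'] at h2
      -- The cylinder transformation makes F jump by log(1 + μp), so exp F is multiplied by exactly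
      -- 1 + μp.
      have h3 : Real.exp (-F s) =
          (1 + graininess T s * p s) * Real.exp (-F (forwardJump T s)) := by
        rw [← Real.exp_log hpos, ← Real.exp_add, ← h2]
        congr 1; ring
      rw [smul_eq_mul] at h1 ⊢
      rw [h3]
      linear_combination Real.exp (-F (forwardJump T s)) * h1
  have h : V t * Real.exp (-F t) ≤ V a * Real.exp (-F a) :=
    le_of_deltaDeriv_nonpos hT ha.1 ht (ha.2 ht) (hVc.mul hFc.neg.rexp).continuousOn hQ fun s hs =>
      mul_nonpos_of_nonpos_of_nonneg (sub_nonpos.2 (hle s hs.1 ⟨t, ht, hs.2.2⟩))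
        (Real.exp_pos _).le
  rw [hF0, neg_zero, Real.exp_zero, mul_one] at h
  rwa [Real.exp_neg, ← div_eq_mul_inv, div_le_iff₀ (Real.exp_pos _)] at h

end Integral

/-! ### Continuity of solutions -/

theorem mem_kappa {T : Set ℝ} {t : ℝ} (ht : t ∈ T) (hne : (T ∩ Ioi t).Nonempty) :
    t ∈ kappa T := by
  obtain ⟨s, hs, hts⟩ := hne
  exact ⟨ht, fun h => absurd (h.1.2 hs) (not_le.2 hts)⟩

theorem continuousWithinAt_of_backwardJump_lt {E : Type*} [TopologicalSpace E] {T : Set ℝ}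
    {t : ℝ} (ht : IsGreatest T t) (hlt : backwardJump T t < t) (x : ℝ → E) :
    ContinuousWithinAt x T t := by
  refine (continuousWithinAt_const (b := x t)).congr_of_eventuallyEq ?_ rfl
  filter_upwards [self_mem_nhdsWithin, mem_nhdsWithin_of_mem_nhds (Ioi_mem_nhds hlt)] with s hs h
  suffices s = t by rw [this]
  refine (ht.2 hs).eq_or_lt.resolve_right fun hst => ?_
  refine absurd (mem_Ioi.1 h) (not_lt.2 ?_)
  unfold backwardJump
  rw [if_pos ⟨s, hs, hst⟩]
  exact le_csSup ⟨t, fun y hy => le_of_lt hy.2⟩ ⟨hs, hst⟩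

/-- Delta differentiability gives continuity on `kappa I`; the only other possible point, a
left-scattered maximum, is isolated. -/
theorem IsSolution.continuousOn {E : Type*} [NormedAddCommGroup E] [NormedSpace ℝ E] {I : Set ℝ}
    {a b : ℝ} {f : ℝ → E → E → E → E} {h g : ℝ → ℝ → E → E} {x : ℝ → E}
    (hx : IsSolution I a b f h g x) : ContinuousOn x I := by
  intro t ht
  by_cases hk : t ∈ kappa I
  · exact (hx.hasDeltaDerivAt t hk).continuousWithinAt ht
  · have : IsGreatest I t ∧ backwardJump I t < t := by
      by_contra hc
      exact hk ⟨ht, hc⟩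
    exact continuousWithinAt_of_backwardJump_lt this.1 this.2 x

end TimeScale

/-! ### The a priori bound -/

theorem theorem5p2 {X : Type*} [NormedAddCommGroup X] [NormedSpace ℝ X] [CompleteSpace X]
    (T : Set ℝ) (hT : IsClosed T) (a b : ℝ) (ha : a ∈ T) (hb : b ∈ T) (hab : a < b)
    (I : Set ℝ) (hI : I = TimeScale.tail T a)
    (f : ℝ → X → X → X → X) (h g : ℝ → ℝ → X → X)
    (hf_rd : ∀ u v w : X, TimeScale.RdContinuous I (fun t => f t u v w))
    (hh_rd : ∀ t ∈ I, ∀ v : X, TimeScale.RdContinuous I (fun s => h t s v))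
    (hg_rd : ∀ t ∈ I, ∀ u : X, TimeScale.RdContinuous I (fun s => g t s u))
    (k₁ k₂ k₃ : ℝ → ℝ)
    (hk₁_rd : TimeScale.RdContinuous I k₁) (hk₁ : ∀ t ∈ I, 0 ≤ k₁ t)
    (hk₂_rd : TimeScale.RdContinuous I k₂) (hk₂ : ∀ t ∈ I, 0 ≤ k₂ t)
    (hk₃_rd : TimeScale.RdContinuous I k₃) (hk₃ : ∀ t ∈ I, 0 ≤ k₃ t)
    (hf : ∀ t ∈ I, ∀ u v w u' v' w' : X,
      ‖f t u v w - f t u' v' w'‖ ≤ k₁ t * (‖u - u'‖ + ‖v - v'‖ + ‖w - w'‖))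
    (hh : ∀ t ∈ I, ∀ s ∈ I, ∀ v v' : X, ‖h t s v - h t s v'‖ ≤ k₂ s * ‖v - v'‖)
    (hg : ∀ t ∈ I, ∀ s ∈ I, ∀ u u' : X, ‖g t s u - g t s u'‖ ≤ k₃ s * ‖u - u'‖)
    (r : ℝ)
    (hr : r = TimeScale.deltaIntegral I
      (fun τ => k₃ τ * TimeScale.deltaExp I (fun s => k₁ s + k₂ s) τ a) a b)
    (hr1 : r < 1)
    (x : ℝ → X) (hx : TimeScale.IsSolution I a b f h g x)
    (hint : ∀ t ∈ I, TimeScale.DeltaIntegrable I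
      (TimeScale.volterraFredholm I a b f h g (fun _ => 0)) a t)
    (m : ℝ)
    (hm : IsLUB ((fun t => ‖x a + TimeScale.deltaIntegral I
      (TimeScale.volterraFredholm I a b f h g (fun _ => 0)) a t‖) '' I) m) :
    ∀ t ∈ I, ‖x t‖ ≤ m / (1 - r) * TimeScale.deltaExp I (fun s => k₁ s + k₂ s) t a := by
  have hIc : IsClosed I := by
    rw [hI]; exact hT.inter isClosed_Ici
  have hIa : IsLeast I a := by
    rw [hI]; exact ⟨⟨ha, self_mem_Ici⟩, fun _ hs => hs.2⟩
  have hbI : b ∈ I := by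
    rw [hI]; exact ⟨hb, hab.le⟩
  have hxc := hx.continuousOn
  have huc : ContinuousOn (fun s => ‖x s‖) I := hxc.norm
  have hp0 : ∀ t ∈ I, 0 ≤ k₁ t + k₂ t := fun t ht => add_nonneg (hk₁ t ht) (hk₂ t ht)
  -- the antiderivatives of the data
  obtain ⟨P, hP0, hPc, hP, hPt⟩ :=
    ((hk₁_rd.add hk₂_rd).cylinder hp0).exists_deltaIntegral_eq hIc hIa
  have hexp : ∀ t ∈ I, TimeScale.deltaExp I (fun s => k₁ s + k₂ s) t a = Real.exp (P t) :=
    fun t ht => by rw [TimeScale.deltaExp, hPt t ht]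
  obtain ⟨K₂, hK₂0, hK₂c, hK₂, -⟩ :=
    (hk₂_rd.mul huc.rdContinuous).exists_deltaIntegral_eq hIc hIa
  obtain ⟨K₃, hK₃0, hK₃c, hK₃, -⟩ :=
    (hk₃_rd.mul huc.rdContinuous).exists_deltaIntegral_eq hIc hIa
  -- Makes the integrand of r rd-continuous, so r is a genuine integral and not the default value 0.
  have hexp_c : ContinuousOn (TimeScale.deltaExp I (fun s => k₁ s + k₂ s) · a) I :=
    (hPc.rexp.continuousOn).congr hexp
  obtain ⟨R, hR0, hRc, hR, hRt⟩ :=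
    (hk₃_rd.mul hexp_c.rdContinuous).exists_deltaIntegral_eq hIc hIa
  have hrR : r = R b := by rw [hr, hRt b hbI]
  set C : ℝ := K₃ b
  have hZ_c : ContinuousOn (fun s => ‖x s‖ + K₂ s + C) I :=
    (huc.add hK₂c.continuousOn).add continuousOn_const
  obtain ⟨Z, hZ0, hZc, hZ, -⟩ :=
    (hk₁_rd.mul hZ_c.rdContinuous).exists_deltaIntegral_eq hIc hIa
  -- the integral terms
  have hh_le : ∀ t ∈ I, ‖TimeScale.deltaIntegral I (fun s => h t s (x s)) a t
      - TimeScale.deltaIntegral I (fun s => h t s 0) a t‖ ≤ K₂ t := fun t ht =>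
    TimeScale.norm_deltaIntegral_sub_le hIc hIa
      (TimeScale.RdContinuous.comp_of_lipschitz (hh_rd t ht) hk₂_rd (hh t ht) hxc)
      (hh_rd t ht 0) hK₂0 hK₂c hK₂
      (fun s hs => by simpa using hh t ht s hs (x s) 0) ht
  have hg_le : ∀ t ∈ I, ‖TimeScale.deltaIntegral I (fun s => g t s (x s)) a b
      - TimeScale.deltaIntegral I (fun s => g t s 0) a b‖ ≤ C := fun t ht =>
    TimeScale.norm_deltaIntegral_sub_le hIc hIa
      (TimeScale.RdContinuous.comp_of_lipschitz (hg_rd t ht) hk₃_rd (hg t ht) hxc)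
      (hg_rd t ht 0) hK₃0 hK₃c hK₃
      (fun s hs => by simpa using hg t ht s hs (x s) 0) hbI
  have hrhs_le : ∀ t ∈ I, ‖TimeScale.volterraFredholm I a b f h g x t
      - TimeScale.volterraFredholm I a b f h g (fun _ => 0) t‖ ≤
        k₁ t * (‖x t‖ + K₂ t + C) := fun t ht => by
    refine (hf t ht _ _ _ _ _ _).trans (mul_le_mul_of_nonneg_left ?_ (hk₁ t ht))
    rw [sub_zero]
    exact add_le_add (add_le_add le_rfl (hh_le t ht)) (hg_le t ht)
  have hK₂_nonneg : ∀ t ∈ I, 0 ≤ K₂ t := fun t ht => (norm_nonneg _).trans (hh_le t ht)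
  have hC_nonneg : 0 ≤ C := (norm_nonneg _).trans (hg_le a hIa.1)
  -- the integral inequality
  have hu_le : ∀ t ∈ I, ‖x t‖ ≤ m + Z t := by
    intro t ht
    have hat : a ≤ t := hIa.2 ht
    -- Nothing is assumed about h and g in their first variable, so the right-hand side at 0 need
    -- not be rd-continuous; its antiderivative comes from `hint`.
    obtain ⟨Y, hY⟩ := hint t ht
    rw [min_eq_left hat, max_eq_right hat] at hY
    have hYt := TimeScale.deltaIntegral_eq_sub hIc hIa.1 ht hat hY
    have h1 := TimeScale.norm_sub_le_of_norm_deltaDeriv_le hIc hIa.1 ht hat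
      (F := fun s => x s - Y s) ((hxc.mono inter_subset_left).sub hY.1) hZc.continuousOn
      (fun s hs => (hx.hasDeltaDerivAt s (TimeScale.mem_kappa hs.1 ⟨t, ht, hs.2.2⟩)).sub hs.1
        (hY.2 s hs))
      (fun s hs => hZ s hs.1 ⟨t, ht, hs.2.2⟩) (fun s hs => hrhs_le s hs.1)
    have h2 := hm.1 ⟨t, ht, rfl⟩
    simp only [hYt] at h2
    have h3 : x t = (x a + (Y t - Y a)) + (x t - Y t - (x a - Y a)) := by abel
    rw [hZ0, sub_zero] at h1
    rw [h3]
    exact (norm_add_le _ _).trans (add_le_add h2 h1)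
  -- Adding C and K₂ to m + Z closes the inequality: the new function bounds both u and u + K₂ + C.
  have hv_le : ∀ t ∈ I, m + C + K₂ t + Z t ≤ (m + C) * Real.exp (P t) := by
    intro t ht
    have h1 := TimeScale.le_mul_exp_of_deltaDeriv_le hIc hIa hp0 hP0 hPc hP
      (V := fun t => m + C + (K₂ t + Z t)) (by fun_prop)
      (fun s hs hne => (TimeScale.hasDeltaDerivAt_const I (m + C) s).add hs
        ((hK₂ s hs hne).add hs (hZ s hs hne)))
      (fun s hs _ => by
        have e1 := mul_le_mul_of_nonneg_left
          (show ‖x s‖ ≤ m + C + (K₂ s + Z s) by linarith [hu_le s hs, hK₂_nonneg s hs])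
          (hk₂ s hs)
        have e2 := mul_le_mul_of_nonneg_left
          (show ‖x s‖ + K₂ s + C ≤ m + C + (K₂ s + Z s) by linarith [hu_le s hs])
          (hk₁ s hs)
        linarith) ht
    simp only [hK₂0, hZ0, add_zero] at h1
    linarith
  have hu_exp : ∀ t ∈ I, ‖x t‖ ≤ (m + C) * Real.exp (P t) := fun t ht => by
    linarith [hu_le t ht, hv_le t ht, hK₂_nonneg t ht]
  -- the Fredholm term is absorbed since `r < 1`
  have hC_le : C ≤ (m + C) * r := by
    have h1 := TimeScale.le_of_deltaDeriv_nonpos hIc hIa.1 hbI hab.le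
      (V := fun t => K₃ t - (m + C) * R t) (by fun_prop)
      (fun s hs => (hK₃ s hs.1 ⟨b, hbI, hs.2.2⟩).sub hs.1
        ((hR s hs.1 ⟨b, hbI, hs.2.2⟩).const_mul (m + C) hs.1))
      (fun s hs => by
        rw [hexp s hs.1]
        linarith [mul_le_mul_of_nonneg_left (hu_exp s hs.1) (hk₃ s hs.1)])
    simp only [hK₃0, hR0, mul_zero, sub_zero] at h1
    rw [hrR]
    linarith
  intro t ht
  rw [hexp t ht]
  refine (hu_exp t ht).trans (mul_le_mul_of_nonneg_right ?_ (Real.exp_pos _).le)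
  rw [le_div_iff₀ (sub_pos.2 hr1)]
  linarith
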